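/- **Setting.** Let $n\ge 1$ and let $\Omega\subset\mathbb R^n$ be a bounded open set. For $r>0$ let $H^r_\Omega(\mathbb R^n)$ be the space of $f\in H^r(\mathbb R^n)$ with $f=0$ a.e. on $\mathbb R^n\setminus\Omega$ (for $r=m+\sigma$, $m\in\mathbb N_0$, $0\le\sigma<1$: the weak derivatives up to order $m$ are in $L^2$ and, if $\sigma>0$, those of order $m$ have finite Gagliardo seminorm of order $\sigma$). For $0<\sigma<1$ it is normed by $$\|f\|_{H^\sigma_\Omega(\mathbb R^n)}=\Big(\int_{\mathbb R^n}\int_{\mathbb R^n}\frac{|f(x)-f(y)|^2}{|x-y|^{n+2\sigma}}\,dy\,dx\Big)^{1/2}.$$ For $0<s<1$ and $0<\delta<\infty$ let $$a(u,v;s,\delta)=\iint_{|x-y|\le\delta}\frac{(u(x)-u(y))(v(x)-v(y))}{|x-y|^{n+2s}}\,dy\,dx .$$ **Choice of intervals and orders.** Let $0<s_{\min}<s_{\max}<1$, $\delta\in(0,\infty)$, $\eta>0$, $\xi\in(1/10,1/2)$ and $0<\varepsilon<\min\{1-s_{\max},\tfrac12\}$. Put $s_{\min,1}=s_{\min}$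 and, as long as $s_{\min,k}<s_{\max}$, $$g_k=\min\{1-s_{\min,k},\tfrac12\}-\varepsilon,\qquad s_{\max,k}=\min\{s_{\max},\ s_{\min,k}+(\tfrac12-\xi)\,g_k\},\qquad s_{\min,k+1}=s_{\max,k};$$ let $K$ be the first index with $s_{\max,K}=s_{\max}$, and let $\mathcal S_k=[s_{\min,k},s_{\max,k}]$, $1\le k\le K$. Let $\overline s_{2,k}=\min\{1,s_{\min,k}+\tfrac12\}-\varepsilon=s_{\min,k}+g_k$, let $C_k(\delta)=4(e^{-1}+\delta^{g_k+1})$ if $\delta>1$ and $C_k(\delta)=4e^{-1}$ if $\delta\le1$, and let $$M_k=\left\lceil\frac{\log(\eta/C_k(\delta))}{\log\frac18(\xi^{-1}-2)}\right\rceil-1 .$$ For $s\in\mathcal S_k$ let $\tilde a(u,v;s,\delta)=\sum_{m=0}^{M_k}\Theta_{\mathcal S_k,m}(s)\,a(u,v;s_m,\delta)$, where $s_0,\dots,s_{M_k}$ are the $M_k+1$ Chebyshev nodes on $\mathcal S_k$ (the zeros of $T_{M_k+1}$ transplanted to $\mathcal S_k$) and $\Theta_{\mathcal S_k,m}$ are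 the corresponding Lagrange polynomials; there are $\max\{M_k+1,0\}$ nodes, and the sum is empty if $M_k<0$. **Claim.** 1. $K$ is finite, and $\mathcal S_1,\dots,\mathcal S_K$ is a subdivision of $[s_{\min},s_{\max}]$ into nondegenerate intervals, with $s_{\max,k}=s_{\min,k}+(\tfrac12-\xi)g_k$ for $k<K$. 2. For all $1\le k\le K$, $s\in\mathcal S_k$, $u\in H^{s+1/2-\varepsilon}_\Omega(\mathbb R^n)$ and $v\in H^s_\Omega(\mathbb R^n)$: $u\in H^{\overline s_{2,k}}_\Omega(\mathbb R^n)$, the integral defining $a(u,v;t,\delta)$ converges absolutely for every $t\in\mathcal S_k$, and $$|a(u,v;s,\delta)-\tilde a(u,v;s,\delta)|\le\eta\,\|u\|_{H^{\overline s_{2,k}}_\Omega(\mathbb R^n)}\|v\|_{H^s_\Omega(\mathbb R^n)} .$$ 3. The total number of interpolation nodes is $O(|\log\eta|)$: for every $\rho>0$ there is a constant $C>0$, depending only on $\rho,\xi,\delta,s_{\max},\varepsilon$, such that, whenever $|\log\eta|\ge\rho$ (in particular for $0<\eta\le e^{-\rho}$), $$\sum_{k=1}^K\max\{M_k+1,0\}\le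 C\,|\log\eta| .$$ -/

import Mathlib

open MeasureTheory Set
open scoped ENNReal

/-! ## Fractional Sobolev spaces on `ℝⁿ` -/

/-- The squared Gagliardo seminorm
`∫∫ |f x - f y|² / |x - y|^(n + 2σ)` over `ℝⁿ × ℝⁿ`, as an extended nonnegative number. -/
noncomputable def gagliardoSq {n : ℕ} (σ : ℝ) (f : EuclideanSpace ℝ (Fin n) → ℝ) : ℝ≥0∞ :=
  ∫⁻ p : EuclideanSpace ℝ (Fin n) × EuclideanSpace ℝ (Fin n),
    ENNReal.ofReal ((f p.1 - f p.2) ^ 2 / ‖p.1 - p.2‖ ^ ((n : ℝ) + 2 * σ))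

/-- `g` is the weak partial derivative of `f` in the `i`-th coordinate direction on `ℝⁿ`. -/
def IsWeakPartial {n : ℕ} (i : Fin n) (f g : EuclideanSpace ℝ (Fin n) → ℝ) : Prop :=
  ∀ φ : EuclideanSpace ℝ (Fin n) → ℝ, ContDiff ℝ (⊤ : ℕ∞) φ → HasCompactSupport φ →
    ∫ x, f x * fderiv ℝ φ x (EuclideanSpace.single i (1 : ℝ)) = - ∫ x, g x * φ x

/-- Membership in `H^(m + σ)(ℝⁿ)` for an integer `m` and `0 ≤ σ < 1`: the weak derivatives up to
order `m` are square integrable and, if `σ > 0`, those of order `m` have finite Gagliardo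
seminorm of order `σ`. -/
def MemHAux {n : ℕ} (σ : ℝ) : ℕ → (EuclideanSpace ℝ (Fin n) → ℝ) → Prop
  | 0, f => MemLp f 2 ∧ (0 < σ → gagliardoSq σ f < ⊤)
  | m + 1, f => MemLp f 2 ∧ ∀ i : Fin n, ∃ g, IsWeakPartial i f g ∧ MemHAux σ m g

/-- Membership in `H^r(ℝⁿ)` for `r ≥ 0`. -/
def MemH {n : ℕ} (r : ℝ) (f : EuclideanSpace ℝ (Fin n) → ℝ) : Prop :=
  MemHAux (r - ⌊r⌋₊) ⌊r⌋₊ f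

/-- Membership in `H^r_Ω(ℝⁿ)`: functions in `H^r(ℝⁿ)` that vanish (almost everywhere)
outside `Ω`. -/
def MemHOmega {n : ℕ} (Ω : Set (EuclideanSpace ℝ (Fin n))) (r : ℝ)
    (f : EuclideanSpace ℝ (Fin n) → ℝ) : Prop :=
  MemH r f ∧ ∀ᵐ x, x ∉ Ω → f x = 0

/-- The norm of `H^σ_Ω(ℝⁿ)` for `0 < σ < 1`, that is, the Gagliardo seminorm on `ℝⁿ`. -/
noncomputable def normHOmega {n : ℕ} (σ : ℝ) (f : EuclideanSpace ℝ (Fin n) → ℝ) : ℝ :=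
  Real.sqrt (gagliardoSq σ f).toReal

/-! ## The truncated bilinear form and its Chebyshev interpolant in `s` -/

/-- The integrand `(u x - u y) (v x - v y) / |x - y|^(n + 2s)`. -/
noncomputable def formIntegrand {n : ℕ} (u v : EuclideanSpace ℝ (Fin n) → ℝ) (s : ℝ)
    (p : EuclideanSpace ℝ (Fin n) × EuclideanSpace ℝ (Fin n)) : ℝ :=
  (u p.1 - u p.2) * (v p.1 - v p.2) / ‖p.1 - p.2‖ ^ ((n : ℝ) + 2 * s)

/-- The strip `S_δ = {(x, y) : |x - y| ≤ δ}`. -/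
def strip (n : ℕ) (δ : ℝ) : Set (EuclideanSpace ℝ (Fin n) × EuclideanSpace ℝ (Fin n)) :=
  {p | ‖p.1 - p.2‖ ≤ δ}

/-- The bilinear form `a(u, v; s, δ)`. -/
noncomputable def bilinForm {n : ℕ} (u v : EuclideanSpace ℝ (Fin n) → ℝ) (s δ : ℝ) : ℝ :=
  ∫ p in strip n δ, formIntegrand u v s p

/-- The `N` Chebyshev nodes on `[a, b]` (the zeros of the transplanted Chebyshev polynomial
`T_N`), indexed by `m = 0, …, N - 1`. -/
noncomputable def chebNode (a b : ℝ) (N m : ℕ) : ℝ :=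
  (a + b) / 2 + (b - a) / 2 * Real.cos ((2 * (m : ℝ) + 1) * Real.pi / (2 * (N : ℝ)))

/-- The interpolated form: the sum of `Θ_m(s) a(u, v; s_m, δ)` over the `N` Chebyshev nodes `s_m`
on `[a, b]`, where `Θ_m` are the Lagrange polynomials of these nodes. -/
noncomputable def interpForm {n : ℕ} (a b : ℝ) (N : ℕ) (u v : EuclideanSpace ℝ (Fin n) → ℝ)
    (s δ : ℝ) : ℝ :=
  ∑ m ∈ Finset.range N,
    (Lagrange.basis (Finset.range N) (chebNode a b N) m).eval s
      * bilinForm u v (chebNode a b N m) δ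

/-! ## The subdivision of `[smin, smax]` and the interpolation orders -/

/-- The gap `g(t) = min {1 - t, 1/2} - ε`. -/
noncomputable def gap (ε t : ℝ) : ℝ := min (1 - t) (1 / 2) - ε

/-- The regularity index `min {1, t + 1/2} - ε` belonging to an interval with left end `t`. -/
noncomputable def sBar (ε t : ℝ) : ℝ := min 1 (t + 1 / 2) - ε

/-- The points of the subdivision: starting from `smin`, the next point is
`t + (1/2 - ξ) g(t)`, cut off at `smax`. -/
noncomputable def breakpoint (ξ ε smin smax : ℝ) : ℕ → ℝ
  | 0 => smin
  | k + 1 => min smax (breakpoint ξ ε smin smax k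
      + (1 / 2 - ξ) * gap ε (breakpoint ξ ε smin smax k))

/-- The number `K` of subintervals: the first index at which the subdivision reaches `smax`. The
subintervals are `[breakpoint k, breakpoint (k + 1)]` for `k = 0, …, K - 1`. -/
noncomputable def numIntervals (ξ ε smin smax : ℝ) : ℕ :=
  sInf {k | breakpoint ξ ε smin smax k = smax}

/-- `ε̂(s) = s₁ + s₂ - 2 s`. -/
def epsHat (s₁ s₂ s : ℝ) : ℝ := s₁ + s₂ - 2 * s

/-- The constant `4 (1/e + δ^(e₀ + 1))` if `δ > 1` and `4 / e` if `δ ≤ 1`. -/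
noncomputable def chebConst (δ e₀ : ℝ) : ℝ :=
  if 1 < δ then 4 * (Real.exp (-1) + δ ^ (e₀ + 1)) else 4 * Real.exp (-1)

/-- `C_k(δ)`, for the subinterval with left end `t`, where `s₁ = t`, `s₂ = sBar ε t` and
`e₀ = ε̂(t)`. -/
noncomputable def intervalConst (ε δ t : ℝ) : ℝ := chebConst δ (epsHat t (sBar ε t) t)

/-- The interpolation order `M_k` on the subinterval with left end `t`, for the tolerance `η`. -/
noncomputable def interpOrder (ξ ε δ η t : ℝ) : ℤ :=
  ⌈Real.log (η / intervalConst ε δ t) / Real.log (1 / 8 * (ξ⁻¹ - 2))⌉ - 1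

/-- The number `max {M_k + 1, 0}` of nodes on the subinterval with left end `t`. -/
noncomputable def numNodes (ξ ε δ η t : ℝ) : ℕ := (interpOrder ξ ε δ η t + 1).toNat

/-!
The truncated form factors as
`a(u, v; t, δ) = ∬ U(x, y) V(x, y) |x - y| ^ (σ + s - 2t)` over `|x - y| ≤ δ`,
where `U` and `V` are the Gagliardo quotients of `u` and `v` of the orders `σ = sBar ε a` and `s`, both
in `L²`. On a subinterval `[a, b]` with `b - a ≤ (1/2 - ξ) g`, `g = gap ε a`, one has `σ = a + g`, so the
exponent is at least `2 ξ g > 0`; this gives the absolute convergence, and it reduces the error estimate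
to the scalar problem of interpolating `t ↦ r ^ (σ + s - 2t)` on `[a, b]` uniformly in `0 < r ≤ δ`
(`abs_bilinForm_sub_interpForm_le`).

The scalar error is the product of `∏ (s - s_m)`, which is at most `2 ((b - a) / 4) ^ N` at Chebyshev
nodes, and of the `N`-th derivative divided by `N!`. For `r ≤ 1` the factor `r ^ (2 ξ g)` absorbs the
powers of `log r`, by Stirling's formula; for `r > 1` the exponential series suffices. The outcome
is `C_k(δ) q ^ N` with `q = (ξ⁻¹ - 2) / 8 < 1` (`abs_rpow_sub_chebyshev_interp_le`), and the number
of nodes is the least one that makes this at most `η` (`chebConst_mul_rate_pow_numNodes_le`).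

The regularity of `u` requires `H^r_Ω ⊆ H^σ_Ω` for `σ < 1`, also when `r ≥ 1` (`MemHOmega.mono`). For
this, `‖u (· + h) - u‖ ≤ C ‖h‖` in `L²` is derived from the weak derivatives by duality with test
functions (`eLpNorm_translate_sub_le`).

The steps of the subdivision are bounded below by `(1/2 - ξ) gap ε smax`, which does not depend on
`smin`; hence the number of intervals, and with it the total number of nodes, is controlled
(`sum_numNodes_le`).
-/

/-! ### Polynomial interpolation at Chebyshev nodes -/

/-- Iterated Rolle theorem: a smooth function with `k + 1` zeros `x 0 < ⋯ < x k` in `[a, b]` has a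
zero of its `k`-th derivative in `[a, b]`. -/
theorem exists_iteratedDeriv_eq_zero {a b : ℝ} (k : ℕ) :
    ∀ {f : ℝ → ℝ} {x : ℕ → ℝ}, ContDiff ℝ (⊤ : ℕ∞) f → (∀ i < k, x i < x (i + 1)) →
      (∀ i ≤ k, x i ∈ Icc a b ∧ f (x i) = 0) → ∃ ζ ∈ Icc a b, iteratedDeriv k f ζ = 0 := by
  induction k with
  | zero =>
    intro f x _ _ h
    exact ⟨x 0, (h 0 le_rfl).1, by simpa using (h 0 le_rfl).2⟩
  | succ k ih =>
    intro f x hf hx h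
    have hz : ∀ i, ∃ z, i < k + 1 → z ∈ Ioo (x i) (x (i + 1)) ∧ deriv f z = 0 := by
      intro i
      by_cases hi : i < k + 1
      · obtain ⟨z, hz, hz'⟩ := exists_deriv_eq_zero (hx i hi) hf.continuous.continuousOn
          ((h i hi.le).2.trans (h (i + 1) hi).2.symm)
        exact ⟨z, fun _ => ⟨hz, hz'⟩⟩
      · exact ⟨0, fun h => absurd h hi⟩
    choose z hz using hz
    rw [iteratedDeriv_succ']
    refine ih (x := z) (contDiff_infty_iff_deriv.1 hf).2 (fun i hi => ?_) (fun i hi => ?_)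
    · exact (hz i (by omega)).1.2.trans (hz (i + 1) (by omega)).1.1
    · obtain ⟨hzi, hz0⟩ := hz i (by omega)
      exact ⟨⟨(h i (by omega)).1.1.trans hzi.1.le, hzi.2.le.trans (h (i + 1) (by omega)).1.2⟩, hz0⟩

theorem exists_iteratedDeriv_eq_zero_of_finset {a b : ℝ} {k : ℕ} {f : ℝ → ℝ} {Z : Finset ℝ}
    (hf : ContDiff ℝ (⊤ : ℕ∞) f) (hcard : Z.card = k + 1)
    (hZ : ∀ z ∈ Z, z ∈ Icc a b ∧ f z = 0) : ∃ ζ ∈ Icc a b, iteratedDeriv k f ζ = 0 := by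
  let e := Z.orderEmbOfFin hcard
  refine exists_iteratedDeriv_eq_zero k (x := fun i => if h : i < k + 1 then e ⟨i, h⟩ else 0) hf
    (fun i hi => ?_) (fun i hi => ?_)
  · have h1 : i < k + 1 := by omega
    have h2 : i + 1 < k + 1 := by omega
    simp only [h1, h2, dif_pos]
    exact e.strictMono (by simp [Fin.lt_def])
  · have h1 : i < k + 1 := by omega
    simp only [h1, dif_pos]
    exact hZ _ (Z.orderEmbOfFin_mem hcard _)

theorem Polynomial.iteratedDeriv_eval (Q : Polynomial ℝ) (k : ℕ) (x : ℝ) :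
    iteratedDeriv k (fun t => Q.eval t) x = (Polynomial.derivative^[k] Q).eval x := by
  induction k generalizing Q with
  | zero => simp
  | succ k ih =>
    rw [iteratedDeriv_succ', Function.iterate_succ_apply, ← ih]
    congr 1
    ext t
    simp

/-- The error formula of Lagrange interpolation at `N` distinct nodes. The degenerate case where `s`
is itself a node is included: both sides vanish there. -/
theorem Lagrange.exists_interpolation_error {a b s : ℝ} {N : ℕ} {x : ℕ → ℝ} {F : ℝ → ℝ}
    (hF : ContDiff ℝ (⊤ : ℕ∞) F) (hinj : Set.InjOn x (Finset.range N))
    (hx : ∀ i ∈ Finset.range N, x i ∈ Icc a b) (hs : s ∈ Icc a b) :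
    ∃ ζ ∈ Icc a b, F s - ∑ i ∈ Finset.range N, (Lagrange.basis (Finset.range N) x i).eval s * F (x i)
      = iteratedDeriv N F ζ / N.factorial * ∏ i ∈ Finset.range N, (s - x i) := by
  set P := Lagrange.interpolate (Finset.range N) x (fun i => F (x i)) with hP
  have hPs : ∑ i ∈ Finset.range N, (Lagrange.basis (Finset.range N) x i).eval s * F (x i)
      = P.eval s := by
    simp [hP, Lagrange.interpolate_apply, Polynomial.eval_finsetSum, mul_comm]
  have hnode : ∀ i ∈ Finset.range N, P.eval (x i) = F (x i) := fun i hi =>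
    Lagrange.eval_interpolate_at_node _ hinj hi
  rw [hPs]
  by_cases hsx : ∃ i ∈ Finset.range N, s = x i
  · obtain ⟨i, hi, rfl⟩ := hsx
    refine ⟨x i, hs, ?_⟩
    rw [hnode i hi, Finset.prod_eq_zero hi (sub_self _)]
    simp
  push Not at hsx
  set W := Lagrange.nodal (Finset.range N) x with hW
  have hWs : W.eval s ≠ 0 := Lagrange.eval_nodal_not_at_node hsx
  -- With this `c`, the function `F - (P + c W)` vanishes at `s` as well as at the `N` nodes.
  set c := (F s - P.eval s) / W.eval s with hc
  set Q := P + Polynomial.C c * W with hQ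
  have hdeg : Polynomial.derivative^[N] Q = Polynomial.C (N.factorial * c) := by
    have h1 : Polynomial.derivative^[N] P = 0 := by
      refine Polynomial.iterate_derivative_eq_zero_of_degree_lt ?_
      have := Lagrange.degree_interpolate_lt (fun i => F (x i)) hinj
      rwa [Finset.card_range] at this
    have h2 : Polynomial.derivative^[N] W = Polynomial.C (N.factorial : ℝ) := by
      have hWd : W.natDegree = N := by simp [hW, Lagrange.natDegree_nodal]
      have h3 : (Polynomial.derivative^[N] W).natDegree = 0 := by
        have := Polynomial.natDegree_iterate_derivative W N
        omega
      rw [Polynomial.eq_C_of_natDegree_eq_zero h3, Polynomial.coeff_iterate_derivative]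
      have h4 : W.coeff (0 + N) = 1 := by
        have := Lagrange.nodal_monic (s := Finset.range N) (v := x)
        rw [zero_add]
        conv_lhs => rw [← hWd]
        exact this
      rw [h4]
      simp [Nat.descFactorial_self]
    rw [hQ, iterate_map_add, h1, Polynomial.iterate_derivative_C_mul, h2, zero_add,
      ← Polynomial.C_mul, mul_comm]
  have hQc : ContDiff ℝ (⊤ : ℕ∞) (fun t => Q.eval t) := by
    simpa using Q.contDiff_aeval (𝕜 := ℝ) (⊤ : ℕ∞)
  have hG : ContDiff ℝ (⊤ : ℕ∞) (fun t => F t - Q.eval t) := hF.sub hQc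
  have hcard : (insert s ((Finset.range N).image x)).card = N + 1 := by
    rw [Finset.card_insert_of_notMem, Finset.card_image_of_injOn hinj, Finset.card_range]
    simp only [Finset.mem_image, not_exists, not_and]
    exact fun i hi h => hsx i hi h.symm
  obtain ⟨ζ, hζ, h0⟩ := exists_iteratedDeriv_eq_zero_of_finset (a := a) (b := b) hG hcard (by
    intro z hz
    rcases Finset.mem_insert.1 hz with rfl | hz
    · refine ⟨hs, ?_⟩
      simp only [hQ, Polynomial.eval_add, Polynomial.eval_mul, Polynomial.eval_C, hc]
      field_simp
      ring
    · obtain ⟨i, hi, rfl⟩ := Finset.mem_image.1 hz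
      refine ⟨hx i hi, ?_⟩
      simp [hQ, hnode i hi, hW, Lagrange.eval_nodal_at_node hi])
  refine ⟨ζ, hζ, ?_⟩
  have h1 : iteratedDeriv N F ζ = N.factorial * c := by
    have := iteratedDeriv_fun_sub (n := N) (x := ζ) (hF.contDiffAt.of_le (by exact_mod_cast le_top))
      (hQc.contDiffAt.of_le (by exact_mod_cast le_top))
    rw [this, Polynomial.iteratedDeriv_eval, hdeg, Polynomial.eval_C, sub_eq_zero] at h0
    exact h0
  rw [h1, ← Lagrange.eval_nodal, ← hW, hc]
  have : (N.factorial : ℝ) ≠ 0 := by positivity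
  field_simp

open Polynomial in
/-- The monic polynomial with the Chebyshev zeros is `2 ^ (1 - N) T_N`, and `|T_N| ≤ 1` on
`[-1, 1]`. -/
theorem abs_prod_sub_cos_le {N : ℕ} {x : ℝ} (hx : |x| ≤ 1) :
    |∏ m ∈ Finset.range N, (x - Real.cos ((2 * (m : ℝ) + 1) * Real.pi / (2 * (N : ℝ))))|
      ≤ 2 * (1 / 2) ^ N := by
  rcases Nat.eq_zero_or_pos N with rfl | hN
  · norm_num
  have hroots := Chebyshev.roots_T_real N
  have hinj := (Finset.range N).nodup_map_iff_injOn.mp (Chebyshev.roots_T_real_nodup N)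
  have hcard : (Chebyshev.T ℝ N).roots.card = (Chebyshev.T ℝ N).natDegree := by
    rw [hroots, Finset.card_val, Finset.card_image_of_injOn hinj, Chebyshev.natDegree_T]
    simp
  have h := C_leadingCoeff_mul_prod_multiset_X_sub_C hcard
  rw [hroots, Chebyshev.leadingCoeff_T] at h
  have h2 := congrArg (eval x) h
  have h3 : (Multiset.map (fun a : ℝ => X - C a) ((Finset.range N).image
      (fun k : ℕ => Real.cos ((2 * k + 1) * Real.pi / (2 * N)))).val).prod
      = ∏ k ∈ Finset.range N, (X - C (Real.cos ((2 * k + 1) * Real.pi / (2 * N)))) := by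
    rw [← Finset.prod_image hinj (f := fun a : ℝ => X - C a)]
    rfl
  rw [h3, eval_mul, eval_C, eval_prod] at h2
  simp only [eval_sub, eval_X, eval_C, Int.natAbs_natCast] at h2
  have h4 := Chebyshev.abs_eval_T_real_le_one N hx
  rw [← h2, abs_mul, abs_of_nonneg (by positivity)] at h4
  obtain ⟨M, rfl⟩ : ∃ M, N = M + 1 := ⟨N - 1, by omega⟩
  have h5 : 2 * (1 / 2 : ℝ) ^ (M + 1) = 1 / 2 ^ M := by
    rw [pow_succ, one_div_pow]; ring
  rw [h5, le_div_iff₀ (by positivity), mul_comm]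
  simpa using h4

theorem abs_prod_sub_chebNode_le {a b s : ℝ} (hab : a < b) (hs : s ∈ Icc a b) (N : ℕ) :
    |∏ m ∈ Finset.range N, (s - chebNode a b N m)| ≤ 2 * ((b - a) / 4) ^ N := by
  set h := (b - a) / 2 with hh
  have hpos : 0 < h := by rw [hh]; linarith
  set x := (s - (a + b) / 2) / h with hx
  have hx1 : |x| ≤ 1 := by
    rw [hx, abs_div, abs_of_pos hpos, div_le_one hpos, abs_le]
    constructor <;> linarith [hs.1, hs.2]
  have : ∀ m ∈ Finset.range N, s - chebNode a b N m
      = h * (x - Real.cos ((2 * (m : ℝ) + 1) * Real.pi / (2 * (N : ℝ)))) := by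
    intro m _
    rw [chebNode, mul_sub, hx, mul_div_cancel₀ _ hpos.ne']
    ring
  rw [Finset.prod_congr rfl this, Finset.prod_mul_distrib, Finset.prod_const, Finset.card_range,
    abs_mul, abs_of_pos (by positivity)]
  calc h ^ N * _ ≤ h ^ N * (2 * (1 / 2) ^ N) := by gcongr; exact abs_prod_sub_cos_le hx1
    _ = 2 * ((b - a) / 4) ^ N := by
      rw [mul_left_comm, ← mul_pow, hh]; ring_nf

theorem chebNode_mem_Icc {a b : ℝ} (hab : a ≤ b) (N m : ℕ) : chebNode a b N m ∈ Icc a b := by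
  rw [chebNode]
  set c := Real.cos ((2 * (m : ℝ) + 1) * Real.pi / (2 * (N : ℝ)))
  have h1 : c ≤ 1 := Real.cos_le_one _
  have h2 : -1 ≤ c := Real.neg_one_le_cos _
  constructor <;> nlinarith

theorem chebNode_injOn {a b : ℝ} (hab : a < b) (N : ℕ) :
    Set.InjOn (chebNode a b N) (Finset.range N) := by
  have hinj := (Finset.range N).nodup_map_iff_injOn.mp (Polynomial.Chebyshev.roots_T_real_nodup N)
  intro i hi j hj hij
  refine hinj hi hj ?_
  have h : (b - a) / 2 ≠ 0 := by linarith
  exact mul_left_cancel₀ h (add_left_cancel hij)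

theorem iteratedDeriv_rpow_affine {r : ℝ} (hr : 0 < r) (A : ℝ) (N : ℕ) :
    iteratedDeriv N (fun t : ℝ => r ^ (A - 2 * t))
      = fun t => (-2 * Real.log r) ^ N * r ^ (A - 2 * t) := by
  induction N with
  | zero => simp
  | succ N ih =>
    rw [iteratedDeriv_succ, ih]
    ext t
    have h : HasDerivAt (fun t : ℝ => r ^ (A - 2 * t)) (Real.log r * (0 - 2 * 1) * r ^ (A - 2 * t)) t :=
      (((hasDerivAt_const t A).sub ((hasDerivAt_id t).const_mul 2))).const_rpow hr
    rw [(h.const_mul _).deriv, pow_succ]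
    ring

/-- A Poisson probability of a positive integer is at most `1 / 2`: the left-hand side is largest at
`y = N`, where Stirling's lower bound for `N!` applies. -/
theorem pow_mul_exp_neg_div_factorial_le {y : ℝ} (hy : 0 ≤ y) {N : ℕ} (hN : 1 ≤ N) :
    y ^ N * Real.exp (-y) / N.factorial ≤ 1 / 2 := by
  have hN' : (1 : ℝ) ≤ N := by exact_mod_cast hN
  have h1 : y ^ N * Real.exp (-y) ≤ (N / Real.exp 1) ^ N := by
    have h2 : y ^ N * Real.exp (-y) = (y * Real.exp (-(y / N))) ^ N := by
      rw [mul_pow, ← Real.exp_nat_mul]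
      congr 2
      field_simp
    rw [h2]
    refine pow_le_pow_left₀ (by positivity) ?_ N
    have h3 := Real.add_one_le_exp (y / N - 1)
    rw [sub_add_cancel, Real.exp_sub, div_le_div_iff₀ (by positivity) (by positivity)] at h3
    rw [Real.exp_neg, ← div_eq_mul_inv, div_le_div_iff₀ (by positivity) (by positivity)]
    linarith
  have h4 := Stirling.le_factorial_stirling N
  have h5 : (2 : ℝ) ≤ √(2 * Real.pi * N) := by
    rw [Real.le_sqrt' (by norm_num)]
    nlinarith [Real.pi_gt_three]
  rw [div_le_iff₀ (by positivity)]
  have h6 : 2 * (N / Real.exp 1) ^ N ≤ (N.factorial : ℝ) :=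
    (mul_le_mul_of_nonneg_right h5 (by positivity)).trans h4
  linarith

theorem one_le_four_mul_exp_neg_one : 1 ≤ 4 * Real.exp (-1) := by
  rw [Real.exp_neg, ← div_eq_mul_inv, le_div_iff₀ (Real.exp_pos _)]
  linarith [Real.exp_one_lt_d9]

theorem one_le_chebConst {δ g : ℝ} (hδ : 0 < δ) : 1 ≤ chebConst δ g := by
  have := one_le_four_mul_exp_neg_one
  rw [chebConst]
  split_ifs with h
  · have : 0 < δ ^ (g + 1) := by positivity
    linarith
  · exact this

/-- Chebyshev interpolation of the kernel `t ↦ r ^ (a + g + s - 2 t)` on `[a, b]`, uniformly in the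
distance `r ≤ δ`. The `N`-th derivative is `(-2 log r) ^ N r ^ e`, where the exponent `e` stays above
`2 ξ g` because `b - a ≤ (1/2 - ξ) g`; the excess `e ≥ 2 ξ g` beats the powers of `log r` as
`r → 0`. The rate `(ξ⁻¹ - 2) / 8` is the quotient of `(1/2 - ξ) g / 2` by `2 ξ g`. -/
theorem abs_rpow_sub_chebyshev_interp_le {δ ξ g a b s r : ℝ} (hδ : 0 < δ)
    (hξ : ξ ∈ Ioo (1 / 10 : ℝ) (1 / 2)) (hg : 0 < g) (hg' : g ≤ 1 / 2) (hab : a < b)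
    (hb : b ≤ a + (1 / 2 - ξ) * g) (hs : s ∈ Icc a b) (hr : 0 < r) (hrδ : r ≤ δ) (N : ℕ) :
    |r ^ (a + g + s - 2 * s) - ∑ m ∈ Finset.range N,
        (Lagrange.basis (Finset.range N) (chebNode a b N) m).eval s
          * r ^ (a + g + s - 2 * chebNode a b N m)|
      ≤ chebConst δ g * (1 / 8 * (ξ⁻¹ - 2)) ^ N := by
  obtain ⟨hξ1, hξ2⟩ := hξ
  have hξ0 : 0 < ξ := by linarith
  set q := 1 / 8 * (ξ⁻¹ - 2) with hq
  have hqξ : q * (2 * ξ * g) = (1 / 2 - ξ) * g / 2 := by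
    rw [hq]; field_simp; ring
  have hq0 : 0 < q := by
    have : 0 < q * (2 * ξ * g) := by rw [hqξ]; have := sub_pos.2 hξ2; positivity
    exact pos_of_mul_pos_left this (by positivity)
  have hF : ContDiff ℝ (⊤ : ℕ∞) (fun t : ℝ => r ^ (a + g + s - 2 * t)) := by
    have : (fun t : ℝ => r ^ (a + g + s - 2 * t))
        = fun t => Real.exp (Real.log r * (a + g + s - 2 * t)) := by
      ext t; rw [Real.rpow_def_of_pos hr]
    rw [this]
    fun_prop
  obtain ⟨ζ, hζ, hE⟩ := Lagrange.exists_interpolation_error hF (chebNode_injOn hab N)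
    (fun i _ => chebNode_mem_Icc hab.le N i) hs
  have hprod := abs_prod_sub_chebNode_le hab hs N
  rw [hE, iteratedDeriv_rpow_affine hr]
  set e := a + g + s - 2 * ζ with he
  have he1 : 2 * ξ * g ≤ e := by
    rw [he]; nlinarith [hs.1, hζ.2]
  have he2 : e + 2 * ξ * g ≤ g + 1 := by
    rw [he]; nlinarith [hs.2, hζ.1]
  have key : |(-2 * Real.log r) ^ N * r ^ e / N.factorial * ∏ m ∈ Finset.range N,
      (s - chebNode a b N m)|
      ≤ 2 * q ^ N * ((2 * ξ * g * |Real.log r|) ^ N / N.factorial * r ^ e) := by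
    have hba : (b - a) / 2 ≤ q * (2 * ξ * g) := by rw [hqξ]; linarith
    have hba0 : 0 ≤ (b - a) / 2 := by linarith
    calc _ = ((2 * |Real.log r|) ^ N * r ^ e / N.factorial)
          * |∏ m ∈ Finset.range N, (s - chebNode a b N m)| := by
          rw [abs_mul, abs_div, abs_mul, abs_pow, abs_mul, Nat.abs_cast,
            abs_of_pos (Real.rpow_pos_of_pos hr e)]
          norm_num
      _ ≤ ((2 * |Real.log r|) ^ N * r ^ e / N.factorial) * (2 * ((b - a) / 4) ^ N) := by
          gcongr
      _ = 2 * ((b - a) / 2) ^ N * (|Real.log r| ^ N / N.factorial * r ^ e) := by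
          have : (2 * |Real.log r|) ^ N * ((b - a) / 4) ^ N = ((b - a) / 2) ^ N * |Real.log r| ^ N := by
            rw [← mul_pow, ← mul_pow]; ring_nf
          linear_combination (2 * r ^ e / N.factorial) * this
      _ ≤ 2 * (q * (2 * ξ * g)) ^ N * (|Real.log r| ^ N / N.factorial * r ^ e) := by
          gcongr
      _ = _ := by rw [mul_pow, mul_pow (2 * ξ * g)]; ring
  have hCexp : 4 * Real.exp (-1) ≤ chebConst δ g := by
    rw [chebConst]
    split_ifs with h
    · have : 0 < δ ^ (g + 1) := by positivity
      linarith
    · exact le_rfl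
  rcases le_or_gt r 1 with h1 | h1
  · refine le_trans ?_ (mul_le_mul_of_nonneg_right
      (one_le_four_mul_exp_neg_one.trans hCexp) (by positivity))
    rw [one_mul]
    -- For `N = 0` the product bound `2` loses a factor `2`, so this case is treated directly.
    rcases Nat.eq_zero_or_pos N with rfl | hN
    · have : r ^ e ≤ 1 := Real.rpow_le_one hr.le h1 (by nlinarith)
      simpa [← he, abs_of_pos (Real.rpow_pos_of_pos hr e)] using this
    · refine key.trans ?_
      set y := 2 * ξ * g * |Real.log r| with hy
      have hy0 : 0 ≤ y := by positivity
      have h2 : r ^ e ≤ Real.exp (-y) := by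
        rw [Real.rpow_def_of_pos hr, Real.exp_le_exp, hy,
          abs_of_nonpos (Real.log_nonpos hr.le h1)]
        nlinarith [Real.log_nonpos hr.le h1]
      have h3 := pow_mul_exp_neg_div_factorial_le hy0 hN
      calc 2 * q ^ N * (y ^ N / N.factorial * r ^ e)
          ≤ 2 * q ^ N * (y ^ N / N.factorial * Real.exp (-y)) := by gcongr
        _ = 2 * q ^ N * (y ^ N * Real.exp (-y) / N.factorial) := by ring
        _ ≤ 2 * q ^ N * (1 / 2) := by gcongr
        _ = q ^ N := by ring
  · have hδ1 : 1 < δ := h1.trans_le hrδ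
    refine key.trans ?_
    have h2 : (2 * ξ * g * |Real.log r|) ^ N / N.factorial ≤ r ^ (2 * ξ * g) := by
      refine (Real.pow_div_factorial_le_exp _ (by positivity) N).trans ?_
      rw [Real.rpow_def_of_pos hr, abs_of_pos (Real.log_pos h1), mul_comm]
    have h3 : r ^ (2 * ξ * g) * r ^ e ≤ δ ^ (g + 1) := by
      rw [← Real.rpow_add hr]
      calc r ^ (2 * ξ * g + e) ≤ r ^ (g + 1) :=
            Real.rpow_le_rpow_of_exponent_le h1.le (by linarith)
        _ ≤ δ ^ (g + 1) := Real.rpow_le_rpow hr.le hrδ (by linarith)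
    calc _ ≤ 2 * q ^ N * (r ^ (2 * ξ * g) * r ^ e) := by gcongr
      _ ≤ 2 * q ^ N * δ ^ (g + 1) := by gcongr
      _ ≤ chebConst δ g * q ^ N := by
        rw [chebConst, if_pos hδ1, mul_right_comm]
        have h4 := Real.exp_pos (-1)
        have h5 : 0 < δ ^ (g + 1) := by positivity
        refine mul_le_mul_of_nonneg_right ?_ (by positivity)
        linarith

/-! ### The subdivision -/

theorem intervalConst_eq (ε δ t : ℝ) : intervalConst ε δ t = chebConst δ (gap ε t) := by
  have h : min 1 (t + 1 / 2) = t + min (1 - t) (1 / 2) := by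
    rw [← min_add_add_left, add_sub_cancel]
  rw [intervalConst, epsHat, sBar, gap, h]
  ring_nf

theorem sBar_eq_add_gap (ε t : ℝ) : sBar ε t = t + gap ε t := by
  have h : min 1 (t + 1 / 2) = t + min (1 - t) (1 / 2) := by
    rw [← min_add_add_left, add_sub_cancel]
  rw [sBar, gap, h]
  ring

theorem gap_anti (ε : ℝ) : Antitone (gap ε) := fun _ _ h =>
  sub_le_sub_right (min_le_min_right _ (sub_le_sub_left h 1)) ε

section Subdivision

variable {ξ ε smin smax : ℝ}

theorem breakpoint_le (h : smin ≤ smax) (k : ℕ) : breakpoint ξ ε smin smax k ≤ smax := by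
  cases k with
  | zero => exact h
  | succ k => exact min_le_left _ _

theorem gap_smax_pos (hε : ε < min (1 - smax) (1 / 2)) : 0 < gap ε smax := sub_pos.2 hε

theorem breakpoint_step_pos (hξ : ξ < 1 / 2) (hε : ε < min (1 - smax) (1 / 2)) :
    0 < (1 / 2 - ξ) * gap ε smax := mul_pos (sub_pos.2 hξ) (gap_smax_pos hε)

theorem add_step_le (hξ : ξ < 1 / 2) {t : ℝ} (ht : t ≤ smax) :
    t + (1 / 2 - ξ) * gap ε smax ≤ t + (1 / 2 - ξ) * gap ε t := by
  have := sub_pos.2 hξ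
  have := gap_anti ε ht
  gcongr

theorem breakpoint_lt_succ (hξ : ξ < 1 / 2) (hε : ε < min (1 - smax) (1 / 2)) {k : ℕ}
    (h : breakpoint ξ ε smin smax k < smax) :
    breakpoint ξ ε smin smax k < breakpoint ξ ε smin smax (k + 1) :=
  lt_min h ((lt_add_of_pos_right _ (breakpoint_step_pos hξ hε)).trans_le (add_step_le hξ h.le))

/-- Since the gap decreases, each step before `smax` is at least `(1/2 - ξ) gap ε smax`, whatever
`smin` is. -/
theorem breakpoint_eq_or_le (hξ : ξ < 1 / 2) (hε : ε < min (1 - smax) (1 / 2))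
    (h : smin ≤ smax) (k : ℕ) :
    breakpoint ξ ε smin smax k = smax ∨
      smin + k * ((1 / 2 - ξ) * gap ε smax) ≤ breakpoint ξ ε smin smax k := by
  have hd := breakpoint_step_pos hξ hε
  induction k with
  | zero => right; simp [breakpoint]
  | succ k ih =>
    have h1 := add_step_le (ε := ε) hξ (breakpoint_le (ξ := ξ) (ε := ε) h k)
    rcases ih with ih | ih
    · left
      rw [breakpoint, min_eq_left]
      rw [ih] at h1 ⊢
      linarith
    · rcases min_choice smax (breakpoint ξ ε smin smax k
        + (1 / 2 - ξ) * gap ε (breakpoint ξ ε smin smax k)) with h2 | h2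
      · exact Or.inl h2
      · right
        rw [breakpoint, h2]
        push_cast
        linarith

theorem breakpoint_ceil_eq (hξ : ξ < 1 / 2) (hε : ε < min (1 - smax) (1 / 2))
    (h0 : 0 < smin) (h : smin ≤ smax) (h1 : smax < 1) :
    breakpoint ξ ε smin smax ⌈1 / ((1 / 2 - ξ) * gap ε smax)⌉₊ = smax := by
  have hd := breakpoint_step_pos hξ hε
  rcases breakpoint_eq_or_le hξ hε h ⌈1 / ((1 / 2 - ξ) * gap ε smax)⌉₊ with h2 | h2
  · exact h2
  · exfalso
    have h3 := breakpoint_le (ξ := ξ) (ε := ε) h ⌈1 / ((1 / 2 - ξ) * gap ε smax)⌉₊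
    have h4 := (div_le_iff₀ hd).1 (Nat.le_ceil (1 / ((1 / 2 - ξ) * gap ε smax)))
    linarith

theorem numIntervals_le (hξ : ξ < 1 / 2) (hε : ε < min (1 - smax) (1 / 2))
    (h0 : 0 < smin) (h : smin ≤ smax) (h1 : smax < 1) :
    numIntervals ξ ε smin smax ≤ ⌈1 / ((1 / 2 - ξ) * gap ε smax)⌉₊ :=
  Nat.sInf_le (breakpoint_ceil_eq hξ hε h0 h h1)

theorem breakpoint_numIntervals (hξ : ξ < 1 / 2) (hε : ε < min (1 - smax) (1 / 2))
    (h0 : 0 < smin) (h : smin ≤ smax) (h1 : smax < 1) :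
    breakpoint ξ ε smin smax (numIntervals ξ ε smin smax) = smax :=
  Nat.sInf_mem (s := {k | breakpoint ξ ε smin smax k = smax})
    ⟨_, breakpoint_ceil_eq hξ hε h0 h h1⟩

theorem breakpoint_lt_smax (h : smin ≤ smax) {k : ℕ} (hk : k < numIntervals ξ ε smin smax) :
    breakpoint ξ ε smin smax k < smax :=
  lt_of_le_of_ne (breakpoint_le h k) fun h' => Nat.notMem_of_lt_sInf hk h'

theorem le_breakpoint (hξ : ξ < 1 / 2) (hε : ε < min (1 - smax) (1 / 2)) (h : smin ≤ smax)
    (k : ℕ) : smin ≤ breakpoint ξ ε smin smax k := by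
  rcases breakpoint_eq_or_le hξ hε h k with h2 | h2
  · rw [h2]; exact h
  · have := breakpoint_step_pos hξ hε
    exact le_trans (le_add_of_nonneg_right (by positivity)) h2

theorem breakpoint_subdivision (hξ : ξ < 1 / 2) (hε : ε < min (1 - smax) (1 / 2))
    (h0 : 0 < smin) (h : smin < smax) (h1 : smax < 1) :
    1 ≤ numIntervals ξ ε smin smax ∧
      breakpoint ξ ε smin smax 0 = smin ∧
      breakpoint ξ ε smin smax (numIntervals ξ ε smin smax) = smax ∧
      (∀ k < numIntervals ξ ε smin smax,
        breakpoint ξ ε smin smax k < breakpoint ξ ε smin smax (k + 1)) ∧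
      (∀ k, k + 1 < numIntervals ξ ε smin smax →
        breakpoint ξ ε smin smax (k + 1) = breakpoint ξ ε smin smax k
          + (1 / 2 - ξ) * gap ε (breakpoint ξ ε smin smax k)) := by
  have hK := breakpoint_numIntervals hξ hε h0 h.le h1
  refine ⟨?_, rfl, hK, fun k hk => breakpoint_lt_succ hξ hε (breakpoint_lt_smax h.le hk), ?_⟩
  · by_contra hlt
    rw [show numIntervals ξ ε smin smax = 0 by omega] at hK
    exact h.ne hK
  · intro k hk
    have h2 := breakpoint_lt_smax h.le hk
    rw [breakpoint] at h2 ⊢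
    rcases min_choice smax (breakpoint ξ ε smin smax k
        + (1 / 2 - ξ) * gap ε (breakpoint ξ ε smin smax k)) with h3 | h3
    · exact absurd h3 h2.ne
    · exact h3

end Subdivision

/-! ### The number of nodes -/

section NodeCount

variable {ξ : ℝ}

theorem rate_pos_lt_one (hξ : ξ ∈ Ioo (1 / 10 : ℝ) (1 / 2)) :
    0 < 1 / 8 * (ξ⁻¹ - 2) ∧ 1 / 8 * (ξ⁻¹ - 2) < 1 := by
  obtain ⟨h1, h2⟩ := hξ
  have h0 : 0 < ξ := by linarith
  have h3 : 2 < ξ⁻¹ := by rw [lt_inv_comm₀ (by norm_num) h0]; linarith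
  have h4 : ξ⁻¹ < 10 := by rw [inv_lt_comm₀ h0 (by norm_num)]; linarith
  constructor <;> linarith

theorem numNodes_eq (ξ ε δ η t : ℝ) : numNodes ξ ε δ η t
    = ⌈Real.log (η / intervalConst ε δ t) / Real.log (1 / 8 * (ξ⁻¹ - 2))⌉.toNat := by
  rw [numNodes, interpOrder, sub_add_cancel]

/-- The number of nodes is chosen so that the interpolation error is at most `η`. -/
theorem chebConst_mul_rate_pow_numNodes_le {ε δ η t : ℝ} (hξ : ξ ∈ Ioo (1 / 10 : ℝ) (1 / 2))
    (hδ : 0 < δ) (hη : 0 < η) :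
    chebConst δ (gap ε t) * (1 / 8 * (ξ⁻¹ - 2)) ^ numNodes ξ ε δ η t ≤ η := by
  obtain ⟨hq0, hq1⟩ := rate_pos_lt_one hξ
  have hC : 0 < chebConst δ (gap ε t) := one_pos.trans_le (one_le_chebConst hδ)
  rw [numNodes_eq, intervalConst_eq]
  set q := 1 / 8 * (ξ⁻¹ - 2)
  set x := Real.log (η / chebConst δ (gap ε t)) / Real.log q
  have hlog : Real.log q < 0 := Real.log_neg hq0 hq1
  have hx : x ≤ (⌈x⌉.toNat : ℝ) :=
    (Int.le_ceil x).trans (by exact_mod_cast Int.self_le_toNat _)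
  have h1 : (⌈x⌉.toNat : ℝ) * Real.log q ≤ Real.log (η / chebConst δ (gap ε t)) :=
    (div_le_iff_of_neg hlog).1 hx
  rw [← Real.log_pow, Real.log_le_log_iff (by positivity) (by positivity), le_div_iff₀ hC] at h1
  rwa [mul_comm]

theorem chebConst_le {δ g : ℝ} (hg : g ≤ 1) :
    chebConst δ g ≤ 4 * (Real.exp (-1) + max 1 δ ^ 2) := by
  rw [chebConst]
  split_ifs with h
  · have h1 : δ ^ (g + 1) ≤ δ ^ (2 : ℝ) :=
      Real.rpow_le_rpow_of_exponent_le h.le (by linarith)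
    rw [max_eq_right h.le]
    rw [Real.rpow_two] at h1
    linarith
  · have : 0 ≤ max 1 δ ^ 2 := by positivity
    linarith

theorem numNodes_le {ε δ η t : ℝ} (hξ : ξ ∈ Ioo (1 / 10 : ℝ) (1 / 2)) (hδ : 0 < δ) (hη : 0 < η)
    (hε : 0 < ε) :
    (numNodes ξ ε δ η t : ℝ) ≤
      (|Real.log η| + Real.log (4 * (Real.exp (-1) + max 1 δ ^ 2)))
        / |Real.log (1 / 8 * (ξ⁻¹ - 2))| + 1 := by
  obtain ⟨hq0, hq1⟩ := rate_pos_lt_one hξ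
  have hC1 := one_le_chebConst (g := gap ε t) hδ
  have hC : 0 < chebConst δ (gap ε t) := one_pos.trans_le hC1
  have hg : gap ε t ≤ 1 := by
    have := min_le_right (1 - t) (1 / 2)
    rw [gap]; linarith
  have hlC := Real.log_le_log hC (chebConst_le hg)
  rw [numNodes_eq, intervalConst_eq]
  have hlog : Real.log (1 / 8 * (ξ⁻¹ - 2)) < 0 := Real.log_neg hq0 hq1
  set x := Real.log (η / chebConst δ (gap ε t)) / Real.log (1 / 8 * (ξ⁻¹ - 2)) with hx
  have h1 : |x| ≤ (|Real.log η| + Real.log (4 * (Real.exp (-1) + max 1 δ ^ 2)))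
        / |Real.log (1 / 8 * (ξ⁻¹ - 2))| := by
    rw [hx, abs_div, Real.log_div hη.ne' hC.ne']
    gcongr
    refine (abs_sub _ _).trans (add_le_add le_rfl ?_)
    rwa [abs_of_nonneg (Real.log_nonneg hC1)]
  have h2 : (⌈x⌉.toNat : ℝ) ≤ |x| + 1 := by
    have h3 : ((⌈x⌉.toNat : ℤ) : ℝ) ≤ |x| + 1 := by
      rw [Int.toNat_eq_max]
      push_cast
      exact max_le ((Int.ceil_lt_add_one x).le.trans (by linarith [le_abs_self x])) (by positivity)
    exact_mod_cast h3
  linarith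

/-- The number of intervals is bounded independently of `smin`, and each carries at most
`(|log η| + B) / |log q| + 1` nodes; the constant terms are absorbed using `|log η| ≥ ρ`. -/
theorem sum_numNodes_le {ε δ smax ρ : ℝ} (hξ : ξ ∈ Ioo (1 / 10 : ℝ) (1 / 2)) (hδ : 0 < δ)
    (hsmax : smax < 1) (hε : 0 < ε) (hε' : ε < min (1 - smax) (1 / 2)) (hρ : 0 < ρ) :
    ∃ C : ℝ, 0 < C ∧ ∀ smin : ℝ, 0 < smin → smin < smax →
      ∀ η : ℝ, 0 < η → ρ ≤ |Real.log η| →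
        ((∑ k ∈ Finset.range (numIntervals ξ ε smin smax),
            numNodes ξ ε δ η (breakpoint ξ ε smin smax k) : ℕ) : ℝ) ≤ C * |Real.log η| := by
  obtain ⟨hq0, hq1⟩ := rate_pos_lt_one hξ
  have hlog : 0 < |Real.log (1 / 8 * (ξ⁻¹ - 2))| := abs_pos.2 (Real.log_neg hq0 hq1).ne
  have hd := breakpoint_step_pos hξ.2 hε'
  set B := Real.log (4 * (Real.exp (-1) + max 1 δ ^ 2)) with hB
  have hB0 : 0 ≤ B := by
    refine Real.log_nonneg ?_
    have := one_le_four_mul_exp_neg_one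
    have : 0 ≤ max 1 δ ^ 2 := by positivity
    linarith
  set L := |Real.log (1 / 8 * (ξ⁻¹ - 2))|
  set K := ⌈1 / ((1 / 2 - ξ) * gap ε smax)⌉₊
  have hK : 0 < K := Nat.ceil_pos.2 (by positivity)
  have hK' : (0 : ℝ) < K := by exact_mod_cast hK
  refine ⟨K * ((1 + B / ρ) / L + 1 / ρ), by positivity, fun smin h0 h η hη hρη => ?_⟩
  have h1 : (1 : ℝ) ≤ |Real.log η| / ρ := (one_le_div hρ).2 hρη
  calc ((∑ k ∈ Finset.range (numIntervals ξ ε smin smax),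
          numNodes ξ ε δ η (breakpoint ξ ε smin smax k) : ℕ) : ℝ)
      = ∑ k ∈ Finset.range (numIntervals ξ ε smin smax),
          (numNodes ξ ε δ η (breakpoint ξ ε smin smax k) : ℝ) := by push_cast; rfl
    _ ≤ ∑ k ∈ Finset.range (numIntervals ξ ε smin smax), ((|Real.log η| + B) / L + 1) :=
        Finset.sum_le_sum fun k _ => numNodes_le hξ hδ hη hε
    _ = numIntervals ξ ε smin smax * ((|Real.log η| + B) / L + 1) := by
        rw [Finset.sum_const, Finset.card_range, nsmul_eq_mul]
    _ ≤ K * ((|Real.log η| + B) / L + 1) := by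
        gcongr
        exact numIntervals_le hξ.2 hε' h0 h.le hsmax
    _ ≤ K * ((|Real.log η| + B * (|Real.log η| / ρ)) / L + |Real.log η| / ρ) := by
        gcongr
        exact le_mul_of_one_le_right hB0 h1
    _ = K * ((1 + B / ρ) / L + 1 / ρ) * |Real.log η| := by ring

end NodeCount

/-! ### Translates of functions with weak derivatives in `L²` -/

theorem abs_integral_mul_le_eLpNorm {α : Type*} [MeasurableSpace α] {μ : Measure α} {f g : α → ℝ}
    (hf : MemLp f 2 μ) (hg : MemLp g 2 μ) :
    |∫ x, f x * g x ∂μ| ≤ (eLpNorm f 2 μ).toReal * (eLpNorm g 2 μ).toReal := by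
  have h := norm_inner_le_norm (𝕜 := ℝ) (hf.toLp f) (hg.toLp g)
  rw [L2.inner_def, Lp.norm_toLp, Lp.norm_toLp, Real.norm_eq_abs] at h
  refine le_of_eq_of_le (congrArg _ (integral_congr_ae ?_)) h
  filter_upwards [hf.coeFn_toLp, hg.coeFn_toLp] with x h1 h2
  rw [h1, h2]
  simp [mul_comm]

section Translation

variable {n : ℕ}

local notation "𝔼" => EuclideanSpace ℝ (Fin n)

/-- The `L²` norm can be tested against smooth compactly supported functions, as these are dense in
`L²`. -/
theorem eLpNorm_le_of_forall_testFunction {f : 𝔼 → ℝ} (hf : MemLp f 2) {C : ℝ} (hC : 0 ≤ C)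
    (h : ∀ φ : 𝔼 → ℝ, ContDiff ℝ (⊤ : ℕ∞) φ → HasCompactSupport φ →
      |∫ x, f x * φ x| ≤ C * (eLpNorm φ 2).toReal) :
    (eLpNorm f 2).toReal ≤ C := by
  have key : ∀ ψ : Lp ℝ 2 (volume : Measure 𝔼), |inner ℝ (hf.toLp f) ψ| ≤ C * ‖ψ‖ := by
    have hcl : IsClosed {ψ : Lp ℝ 2 (volume : Measure 𝔼) |
        |inner ℝ (hf.toLp f) ψ| ≤ C * ‖ψ‖} := isClosed_le (by fun_prop) (by fun_prop)
    refine fun ψ => closure_minimal ?_ hcl (Lp.dense_hasCompactSupport_contDiff (by norm_num) ψ)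
    rintro ψ ⟨φ, hφ, hc, hs⟩
    have h1 := h φ hs hc
    rw [mem_ofPred_eq]
    rw [← eLpNorm_congr_ae hφ, ← Lp.norm_def] at h1
    refine le_of_eq_of_le (congrArg _ ?_) h1
    rw [L2.inner_def]
    refine integral_congr_ae ?_
    filter_upwards [hf.coeFn_toLp, hφ] with x h1 h2
    rw [h1, h2]
    simp [mul_comm]
  have h1 := key (hf.toLp f)
  rw [real_inner_self_eq_norm_mul_norm, abs_of_nonneg (by positivity), Lp.norm_toLp] at h1
  by_contra! hlt
  exact absurd (le_of_mul_le_mul_right h1 (hC.trans_lt hlt)) (not_le.2 hlt)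

/-- The directional derivative `∫ u(y) Dk(z - y) v dy` of `u ⋆ k` at `z`: the test function
`y ↦ k (z - y)` moves the derivative from `k` to `u`, and Cauchy-Schwarz applies. -/
theorem abs_convolution_fderiv_le {u : 𝔼 → ℝ} {g : Fin n → 𝔼 → ℝ} (hu : MemLp u 2)
    (hg : ∀ i, MemLp (g i) 2) (hw : ∀ i, IsWeakPartial i u (g i)) {k : 𝔼 → ℝ}
    (hk : ContDiff ℝ (⊤ : ℕ∞) k) (hc : HasCompactSupport k) (z v : 𝔼) :
    |∫ y, u y * fderiv ℝ k (z - y) v|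
      ≤ ‖v‖ * (∑ i, (eLpNorm (g i) 2).toReal) * (eLpNorm k 2).toReal := by
  set φ : 𝔼 → ℝ := fun y => k (z - y) with hφ
  have hφs : ContDiff ℝ (⊤ : ℕ∞) φ := hk.comp (contDiff_const.sub contDiff_id)
  have hφc : HasCompactSupport φ := hc.comp_homeomorph (Homeomorph.subLeft z)
  have hφm : eLpNorm φ 2 = eLpNorm k 2 := by
    exact eLpNorm_comp_measurePreserving hk.continuous.aestronglyMeasurable
      (Measure.measurePreserving_sub_left volume z)
  have hφL : MemLp φ 2 := hφs.continuous.memLp_of_hasCompactSupport hφc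
  have hD : ∀ y w, fderiv ℝ φ y w = - fderiv ℝ k (z - y) w := by
    intro y w
    have h1 : HasFDerivAt φ ((fderiv ℝ k (z - y)).comp (-ContinuousLinearMap.id ℝ 𝔼)) y := by
      refine HasFDerivAt.comp y ((hk.differentiable (by simp)).differentiableAt.hasFDerivAt) ?_
      simpa using (hasFDerivAt_id y).const_sub z
    rw [h1.fderiv]
    simp
  have hv : v = ∑ i, v i • EuclideanSpace.single i (1 : ℝ) := by
    have := (EuclideanSpace.basisFun (Fin n) ℝ).sum_repr v
    simpa using this.symm
  have hint : ∀ i : Fin n,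
      Integrable (fun y => u y * fderiv ℝ φ y (EuclideanSpace.single i (1 : ℝ))) := by
    intro i
    have hd : MemLp (fun y => fderiv ℝ φ y (EuclideanSpace.single i (1 : ℝ))) 2 := by
      refine Continuous.memLp_of_hasCompactSupport ?_ ?_
      · exact (hφs.continuous_fderiv (by simp)).clm_apply continuous_const
      · exact (hφc.fderiv (𝕜 := ℝ)).comp_left
          (g := fun L : 𝔼 →L[ℝ] ℝ => L (EuclideanSpace.single i (1 : ℝ))) (by simp)
    exact hu.integrable_mul hd
  have h1 : ∫ y, u y * fderiv ℝ k (z - y) v = ∑ i, v i * ∫ y, g i y * φ y := by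
    calc ∫ y, u y * fderiv ℝ k (z - y) v
        = ∫ y, ∑ i, -v i * (u y * fderiv ℝ φ y (EuclideanSpace.single i (1 : ℝ))) := by
          congr 1
          ext y
          have : fderiv ℝ k (z - y) v = -fderiv ℝ φ y v := by rw [hD, neg_neg]
          rw [this]
          conv_lhs => rw [hv]
          rw [map_sum, ← Finset.sum_neg_distrib, Finset.mul_sum]
          refine Finset.sum_congr rfl fun i _ => ?_
          rw [map_smul, smul_eq_mul]
          ring
      _ = ∑ i, -v i * ∫ y, u y * fderiv ℝ φ y (EuclideanSpace.single i (1 : ℝ)) := by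
          rw [integral_finsetSum _ fun i _ => (hint i).const_mul _]
          exact Finset.sum_congr rfl fun i _ => integral_const_mul _ _
      _ = _ := by
          refine Finset.sum_congr rfl fun i _ => ?_
          rw [hw i φ hφs hφc]
          ring
  rw [h1, ← hφm]
  calc |∑ i, v i * ∫ y, g i y * φ y| ≤ ∑ i, |v i * ∫ y, g i y * φ y| :=
        Finset.abs_sum_le_sum_abs _ _
    _ ≤ ∑ i, ‖v‖ * ((eLpNorm (g i) 2).toReal * (eLpNorm φ 2).toReal) := by
        refine Finset.sum_le_sum fun i _ => ?_
        rw [abs_mul]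
        gcongr
        · exact PiLp.norm_apply_le v i
        · exact abs_integral_mul_le_eLpNorm (hg i) hφL
    _ = _ := by rw [Finset.mul_sum, Finset.sum_mul]; simp only [mul_assoc]

/-- Difference quotients of a function with weak gradient in `L²` are bounded in `L²`. Tested against
`φ`, the difference is the increment between `0` and `h` of the smooth function `u ⋆ φ(-·)`, to
which the mean value inequality applies. -/
theorem eLpNorm_translate_sub_le {u : 𝔼 → ℝ} {g : Fin n → 𝔼 → ℝ} (hu : MemLp u 2)
    (hg : ∀ i, MemLp (g i) 2) (hw : ∀ i, IsWeakPartial i u (g i)) (h : 𝔼) :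
    eLpNorm (fun x => u (x + h) - u x) 2
      ≤ ENNReal.ofReal (‖h‖ * ∑ i, (eLpNorm (g i) 2).toReal) := by
  have hτ : MemLp (fun x => u (x + h)) 2 :=
    hu.comp_measurePreserving (measurePreserving_add_right volume h)
  have hf : MemLp (fun x => u (x + h) - u x) 2 := hτ.sub hu
  rw [← ENNReal.ofReal_toReal hf.2.ne]
  refine ENNReal.ofReal_le_ofReal (eLpNorm_le_of_forall_testFunction hf (by positivity) fun φ hφ hc => ?_)
  set k : 𝔼 → ℝ := fun y => φ (-y) with hk
  have hks : ContDiff ℝ (⊤ : ℕ∞) k := hφ.comp contDiff_neg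
  have hkc : HasCompactSupport k := hc.comp_homeomorph (Homeomorph.neg 𝔼)
  have hkm : eLpNorm k 2 = eLpNorm φ 2 :=
    eLpNorm_comp_measurePreserving hφ.continuous.aestronglyMeasurable
      (Measure.measurePreserving_neg volume)
  have hloc : LocallyIntegrable u := hu.locallyIntegrable (by norm_num)
  have hφL : MemLp φ 2 := hφ.continuous.memLp_of_hasCompactSupport hc
  set L := ContinuousLinearMap.mul ℝ ℝ
  have hder : ∀ z, HasFDerivAt (convolution u k L volume)
      ((convolution u (fderiv ℝ k) (L.precompR 𝔼) volume) z) z := fun z =>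
    hkc.hasFDerivAt_convolution_right L hloc (hks.of_le (by exact_mod_cast le_top)) z
  have hbound : ∀ z, ‖(convolution u (fderiv ℝ k) (L.precompR 𝔼) volume) z‖
      ≤ (∑ i, (eLpNorm (g i) 2).toReal) * (eLpNorm φ 2).toReal := by
    intro z
    refine ContinuousLinearMap.opNorm_le_bound _ (by positivity) fun v => ?_
    rw [convolution_precompR_apply L hloc (hkc.fderiv (𝕜 := ℝ))
      (hks.continuous_fderiv (by simp)), Real.norm_eq_abs, ← hkm]
    refine (abs_convolution_fderiv_le hu hg hw hks hkc z v).trans (le_of_eq ?_)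
    ring
  have hmvt := Convex.norm_image_sub_le_of_norm_hasFDerivWithin_le (𝕜 := ℝ)
    (fun z _ => (hder z).hasFDerivWithinAt) (fun z _ => hbound z) convex_univ
    (mem_univ (0 : 𝔼)) (mem_univ h)
  have hconv : ∀ z, convolution u k L volume z = ∫ y, u (y + z) * φ y := by
    intro z
    rw [convolution_def, ← integral_add_right_eq_self _ z]
    simp [L, hk]
  rw [hconv, hconv, sub_zero] at hmvt
  have h0 : ∫ x, (u (x + h) - u x) * φ x = (∫ y, u (y + h) * φ y) - ∫ y, u (y + 0) * φ y := by
    simp only [add_zero, sub_mul]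
    exact integral_sub (hτ.integrable_mul hφL) (hu.integrable_mul hφL)
  rw [h0, ← Real.norm_eq_abs]
  refine hmvt.trans (le_of_eq ?_)
  ring

end Translation

/-! ### Gagliardo seminorms -/

/-- The quotient `(f x - f y) / |x - y| ^ (n / 2 + σ)`, a function on `ℝⁿ × ℝⁿ` whose `L²` norm is the
Gagliardo seminorm of order `σ`. It vanishes on the diagonal. -/
noncomputable def gagliardoQuot {n : ℕ} (σ : ℝ) (f : EuclideanSpace ℝ (Fin n) → ℝ)
    (p : EuclideanSpace ℝ (Fin n) × EuclideanSpace ℝ (Fin n)) : ℝ :=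
  (f p.1 - f p.2) / ‖p.1 - p.2‖ ^ (((n : ℝ) + 2 * σ) / 2)

section Gagliardo

variable {n : ℕ}

local notation "𝔼" => EuclideanSpace ℝ (Fin n)

theorem aestronglyMeasurable_gagliardoQuot {f : 𝔼 → ℝ} (hf : AEStronglyMeasurable f) (σ : ℝ) :
    AEStronglyMeasurable (gagliardoQuot σ f) := by
  have h1 : AEStronglyMeasurable (fun p : 𝔼 × 𝔼 => f p.1) := hf.comp_fst
  have h2 : AEStronglyMeasurable (fun p : 𝔼 × 𝔼 => f p.2) := hf.comp_snd
  have h3 : Measurable (fun p : 𝔼 × 𝔼 => ‖p.1 - p.2‖ ^ (((n : ℝ) + 2 * σ) / 2)) := by fun_prop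
  exact ((h1.sub h2).aemeasurable.div h3.aemeasurable).aestronglyMeasurable

theorem eLpNorm_two_sq {α : Type*} [MeasurableSpace α] {μ : Measure α} (f : α → ℝ) :
    eLpNorm f 2 μ ^ 2 = ∫⁻ x, ENNReal.ofReal (f x ^ 2) ∂μ := by
  have h := eLpNorm_nnreal_pow_eq_lintegral (μ := μ) (f := f) (p := 2) (by norm_num)
  have h' : eLpNorm f 2 μ ^ 2 = ∫⁻ x, ‖f x‖ₑ ^ 2 ∂μ := by
    simpa using h
  rw [h']
  congr 1
  ext x
  rw [← sq_abs, ENNReal.ofReal_pow (abs_nonneg _), Real.enorm_eq_ofReal_abs]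

theorem gagliardoQuot_sq (σ : ℝ) (f : 𝔼 → ℝ) (p : 𝔼 × 𝔼) :
    gagliardoQuot σ f p ^ 2 = (f p.1 - f p.2) ^ 2 / ‖p.1 - p.2‖ ^ ((n : ℝ) + 2 * σ) := by
  rw [gagliardoQuot, div_pow, ← Real.rpow_natCast (‖p.1 - p.2‖ ^ _), ← Real.rpow_mul (norm_nonneg _)]
  norm_num

theorem eLpNorm_gagliardoQuot_sq (σ : ℝ) (f : 𝔼 → ℝ) :
    eLpNorm (gagliardoQuot σ f) 2 ^ 2 = gagliardoSq σ f := by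
  rw [eLpNorm_two_sq, gagliardoSq]
  simp only [gagliardoQuot_sq]

theorem memLp_gagliardoQuot {σ : ℝ} {f : 𝔼 → ℝ} (hf : AEStronglyMeasurable f)
    (h : gagliardoSq σ f < ⊤) : MemLp (gagliardoQuot σ f) 2 := by
  refine ⟨aestronglyMeasurable_gagliardoQuot hf σ, ?_⟩
  rw [← eLpNorm_gagliardoQuot_sq] at h
  exact (ENNReal.pow_lt_top_iff.1 h).resolve_right (by norm_num)

theorem toReal_eLpNorm_gagliardoQuot (σ : ℝ) (f : 𝔼 → ℝ) :
    (eLpNorm (gagliardoQuot σ f) 2).toReal = normHOmega σ f := by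
  rw [normHOmega, ← eLpNorm_gagliardoQuot_sq, ENNReal.toReal_pow,
    Real.sqrt_sq ENNReal.toReal_nonneg]

/-- The Gagliardo seminorm in terms of the translates `f (· + h)`. -/
theorem gagliardoSq_eq_lintegral_translate {f : 𝔼 → ℝ} (hf : AEStronglyMeasurable f) (σ : ℝ) :
    gagliardoSq σ f = ∫⁻ h : 𝔼, ENNReal.ofReal ((‖h‖ ^ ((n : ℝ) + 2 * σ))⁻¹)
      * eLpNorm (fun x => f (x + h) - f x) 2 ^ 2 := by
  have hm : AEMeasurable (fun p : 𝔼 × 𝔼 =>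
      ENNReal.ofReal ((f p.1 - f p.2) ^ 2 / ‖p.1 - p.2‖ ^ ((n : ℝ) + 2 * σ))) := by
    have := ((aestronglyMeasurable_gagliardoQuot hf σ).aemeasurable.pow_const 2).ennreal_ofReal
    simpa only [gagliardoQuot_sq] using this
  have hT : MeasurePreserving (MeasurableEquiv.shearAddRight 𝔼) (volume.prod volume)
      (volume.prod volume) := measurePreserving_prod_add volume volume
  have h1 : gagliardoSq σ f = ∫⁻ p : 𝔼 × 𝔼,
      ENNReal.ofReal ((f p.1 - f (p.1 + p.2)) ^ 2 / ‖p.1 - (p.1 + p.2)‖ ^ ((n : ℝ) + 2 * σ))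
      ∂(volume.prod volume) := by
    rw [gagliardoSq, Measure.volume_eq_prod]
    conv_lhs => rw [← hT.map_eq]
    rw [lintegral_map_equiv]
    rfl
  rw [h1, lintegral_prod_symm]
  · congr 1
    ext h
    rw [eLpNorm_two_sq, ← lintegral_const_mul'' ]
    · congr 1
      ext x
      rw [← ENNReal.ofReal_mul (by positivity)]
      congr 1
      rw [show x - (x + h) = -h by abel, norm_neg]
      ring
    · have h2 : AEStronglyMeasurable (fun x => f (x + h)) :=
        hf.comp_measurePreserving (measurePreserving_add_right volume h)
      exact ((h2.sub hf).aemeasurable.pow_const 2).ennreal_ofReal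
  · have := (hm.comp_quasiMeasurePreserving hT.quasiMeasurePreserving)
    exact this

theorem lintegral_compl_ball_inv_rpow_lt_top {α : ℝ} (hα : (n : ℝ) < α) :
    ∫⁻ h in (Metric.ball (0 : 𝔼) 1)ᶜ, ENNReal.ofReal ((‖h‖ ^ α)⁻¹) < ⊤ := by
  have hα0 : 0 < α := (Nat.cast_nonneg n).trans_lt hα
  have hi : Integrable (fun h : 𝔼 => (1 + ‖h‖) ^ (-α)) :=
    integrable_one_add_norm (by simpa using hα)
  have h2 := (hi.const_mul (2 ^ α)).lintegral_lt_top
  refine lt_of_le_of_lt ((setLIntegral_mono' Metric.isOpen_ball.measurableSet.compl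
    fun h hh => ?_).trans (setLIntegral_le_lintegral _ _)) h2
  have h1 : 1 ≤ ‖h‖ := by simpa using hh
  refine ENNReal.ofReal_le_ofReal ?_
  rw [Real.rpow_neg (by positivity), ← div_eq_mul_inv, inv_eq_one_div,
    div_le_div_iff₀ (by positivity) (by positivity), one_mul,
    ← Real.mul_rpow (by norm_num) (by positivity)]
  exact Real.rpow_le_rpow (by positivity) (by linarith) hα0.le

/-- Long translates never matter for square integrable functions: `‖f (· + h) - f‖ ≤ 2 ‖f‖`, and
`‖h‖ ^ (-n - 2σ)` is integrable away from the origin. -/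
theorem gagliardoSq_lt_top_of_ball {f : 𝔼 → ℝ} (hf : MemLp f 2) {σ : ℝ} (hσ : 0 < σ)
    (h : ∫⁻ h in Metric.ball (0 : 𝔼) 1, ENNReal.ofReal ((‖h‖ ^ ((n : ℝ) + 2 * σ))⁻¹)
      * eLpNorm (fun x => f (x + h) - f x) 2 ^ 2 < ⊤) : gagliardoSq σ f < ⊤ := by
  rw [gagliardoSq_eq_lintegral_translate hf.1, ← lintegral_add_compl _
    (Metric.isOpen_ball (x := (0 : 𝔼)) (ε := 1)).measurableSet]
  refine ENNReal.add_lt_top.2 ⟨h, ?_⟩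
  have hb : ∀ h : 𝔼, eLpNorm (fun x => f (x + h) - f x) 2 ≤ 2 * eLpNorm f 2 := by
    intro h
    have hτ := measurePreserving_add_right (volume : Measure 𝔼) h
    have h1 := eLpNorm_sub_le (p := 2) (hf.1.comp_measurePreserving hτ) hf.1 (by norm_num)
    rw [eLpNorm_comp_measurePreserving hf.1 hτ, ← two_mul] at h1
    exact h1
  have hfin : (2 * eLpNorm f 2 (volume : Measure 𝔼)) ^ 2 < ⊤ :=
    ENNReal.pow_lt_top (ENNReal.mul_lt_top ENNReal.ofNat_lt_top hf.2)
  have hα : (n : ℝ) < (n : ℝ) + 2 * σ := by linarith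
  refine lt_of_le_of_lt (lintegral_mono fun h => ?_)
    (lt_of_eq_of_lt (lintegral_mul_const _ ?_)
      (ENNReal.mul_lt_top (lintegral_compl_ball_inv_rpow_lt_top hα) hfin))
  · gcongr
    exact hb h
  · fun_prop

theorem gagliardoSq_lt_top_mono {f : 𝔼 → ℝ} (hf : MemLp f 2) {σ τ : ℝ} (hn : 1 ≤ n) (hσ : 0 < σ)
    (hστ : σ ≤ τ) (h : gagliardoSq τ f < ⊤) : gagliardoSq σ f < ⊤ := by
  refine gagliardoSq_lt_top_of_ball hf hσ (lt_of_le_of_lt ?_ h)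
  rw [gagliardoSq_eq_lintegral_translate hf.1]
  refine (setLIntegral_mono' Metric.isOpen_ball.measurableSet fun h hh => ?_).trans
    (setLIntegral_le_lintegral _ _)
  have h1 : ‖h‖ ≤ 1 := by simpa using (mem_ball_zero_iff.1 hh).le
  refine mul_le_mul_left (ENNReal.ofReal_le_ofReal ?_) _
  rcases (norm_nonneg h).eq_or_lt with h0 | h0
  · have hn' : (1 : ℝ) ≤ n := by exact_mod_cast hn
    rw [← h0, Real.zero_rpow (by linarith), Real.zero_rpow (by linarith)]
  · exact inv_anti₀ (by positivity) (Real.rpow_le_rpow_of_exponent_ge h0 h1 (by linarith))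

/-- `H¹ ⊆ H^σ` for `0 < σ < 1`: near the origin the squared translation difference is `O(‖h‖²)`, and
`‖h‖ ^ (2 - n - 2σ)` is integrable there. -/
theorem gagliardoSq_lt_top_of_weakPartial {u : 𝔼 → ℝ} {g : Fin n → 𝔼 → ℝ} (hn : 1 ≤ n)
    (hu : MemLp u 2) (hg : ∀ i, MemLp (g i) 2) (hw : ∀ i, IsWeakPartial i u (g i)) {σ : ℝ}
    (hσ : 0 < σ) (hσ1 : σ < 1) : gagliardoSq σ u < ⊤ := by
  refine gagliardoSq_lt_top_of_ball hu hσ ?_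
  set G := ∑ i, (eLpNorm (g i) 2).toReal with hG
  have hint : IntegrableOn (fun h : 𝔼 => ‖h‖ ^ (-((n : ℝ) + 2 * σ - 2))) (Metric.ball 0 1) := by
    refine integrableOn_ball_of_norm_le_rpow (C := 1) (α := (n : ℝ) + 2 * σ - 2) ?_ ?_ ?_ ?_
    · simpa using hn
    · simp; linarith
    · refine Filter.Eventually.of_forall fun h => ?_
      rw [one_mul, Real.norm_of_nonneg (by positivity)]
    · exact Measurable.aestronglyMeasurable (by fun_prop)
  refine lt_of_le_of_lt (setLIntegral_mono' Metric.isOpen_ball.measurableSet fun h _ => ?_)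
    (hint.const_mul (G ^ 2)).lintegral_lt_top
  calc _ ≤ ENNReal.ofReal ((‖h‖ ^ ((n : ℝ) + 2 * σ))⁻¹) * ENNReal.ofReal (‖h‖ * G) ^ 2 := by
        gcongr
        exact eLpNorm_translate_sub_le hu hg hw h
    _ = ENNReal.ofReal ((‖h‖ ^ ((n : ℝ) + 2 * σ))⁻¹ * (‖h‖ * G) ^ 2) := by
        rw [← ENNReal.ofReal_pow (by positivity), ← ENNReal.ofReal_mul (by positivity)]
    _ ≤ _ := by
        refine ENNReal.ofReal_le_ofReal ?_
        rcases (norm_nonneg h).eq_or_lt with h0 | h0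
        · rw [← h0]
          have := Real.rpow_nonneg le_rfl (-((n : ℝ) + 2 * σ - 2))
          simp
          positivity
        · rw [neg_sub, Real.rpow_sub h0, Real.rpow_two]
          refine le_of_eq ?_
          ring

theorem memHOmega_iff_of_lt_one {Ω : Set 𝔼} {σ : ℝ} (hσ : 0 < σ) (hσ1 : σ < 1) {f : 𝔼 → ℝ} :
    MemHOmega Ω σ f ↔ (MemLp f 2 ∧ gagliardoSq σ f < ⊤) ∧ ∀ᵐ x, x ∉ Ω → f x = 0 := by
  have : ⌊σ⌋₊ = 0 := Nat.floor_eq_zero.2 hσ1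
  rw [MemHOmega, MemH, this, MemHAux]
  simp [hσ]

theorem MemHAux.memLp {σ : ℝ} {m : ℕ} {f : 𝔼 → ℝ} (h : MemHAux σ m f) : MemLp f 2 := by
  cases m with
  | zero => exact h.1
  | succ m => exact h.1

/-- The inclusion `H^r_Ω ⊆ H^σ_Ω` for `0 < σ < 1` and `σ ≤ r`. For `r ≥ 1` only the first weak
derivatives are used. -/
theorem MemHOmega.mono {Ω : Set 𝔼} {σ r : ℝ} (hn : 1 ≤ n) (hσ : 0 < σ) (hσ1 : σ < 1)
    (hr : σ ≤ r) {f : 𝔼 → ℝ} (h : MemHOmega Ω r f) : MemHOmega Ω σ f := by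
  rw [memHOmega_iff_of_lt_one hσ hσ1]
  refine ⟨⟨h.1.memLp, ?_⟩, h.2⟩
  obtain ⟨h1, -⟩ := h
  rw [MemH] at h1
  rcases hm : ⌊r⌋₊ with _ | m
  · rw [hm] at h1
    have h2 := h1.2 (by simpa using hσ.trans_le hr)
    rw [Nat.cast_zero, sub_zero] at h2
    exact gagliardoSq_lt_top_mono h1.1 hn hσ hr h2
  · rw [hm] at h1
    obtain ⟨hu, h2⟩ := h1
    choose g hg hg' using h2
    exact gagliardoSq_lt_top_of_weakPartial hn hu (fun i => (hg' i).memLp) hg hσ hσ1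

end Gagliardo

/-! ### The bilinear form and its interpolant -/

section Form

variable {n : ℕ}

local notation "𝔼" => EuclideanSpace ℝ (Fin n)

/-- The orders `σ` and `s` of the two factors are fixed, so that the parameter `t` of the form enters
through a power of `|x - y|` only. On the diagonal both sides are zero. -/
theorem formIntegrand_eq_gagliardoQuot_mul (u v : 𝔼 → ℝ) (σ s t : ℝ) (p : 𝔼 × 𝔼) :
    formIntegrand u v t p
      = gagliardoQuot σ u p * gagliardoQuot s v p * ‖p.1 - p.2‖ ^ (σ + s - 2 * t) := by
  rcases (norm_nonneg (p.1 - p.2)).eq_or_lt with h | h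
  · have : p.1 = p.2 := sub_eq_zero.1 (norm_eq_zero.1 h.symm)
    simp [formIntegrand, gagliardoQuot, this]
  · have h1 : ‖p.1 - p.2‖ ^ (((n : ℝ) + 2 * σ) / 2) * ‖p.1 - p.2‖ ^ (((n : ℝ) + 2 * s) / 2)
        = ‖p.1 - p.2‖ ^ ((n : ℝ) + 2 * t) * ‖p.1 - p.2‖ ^ (σ + s - 2 * t) := by
      rw [← Real.rpow_add h, ← Real.rpow_add h]
      ring_nf
    rw [formIntegrand, gagliardoQuot, gagliardoQuot, div_mul_div_comm, h1,
      div_mul_eq_mul_div, mul_div_mul_right _ _ (Real.rpow_pos_of_pos h _).ne']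

theorem measurableSet_strip (n : ℕ) (δ : ℝ) : MeasurableSet (strip n δ) :=
  measurableSet_le (by fun_prop) measurable_const

theorem integrableOn_formIntegrand {u v : 𝔼 → ℝ} {σ s t δ : ℝ}
    (hu : MemLp (gagliardoQuot σ u) 2) (hv : MemLp (gagliardoQuot s v) 2)
    (ht : 0 ≤ σ + s - 2 * t) : IntegrableOn (formIntegrand u v t) (strip n δ) := by
  have hW : Integrable (fun p => gagliardoQuot σ u p * gagliardoQuot s v p) :=
    hu.integrable_mul hv
  have hm : Measurable (fun p : 𝔼 × 𝔼 => ‖p.1 - p.2‖ ^ (σ + s - 2 * t)) := by fun_prop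
  have he : formIntegrand u v t = fun p =>
      gagliardoQuot σ u p * gagliardoQuot s v p * ‖p.1 - p.2‖ ^ (σ + s - 2 * t) :=
    funext (formIntegrand_eq_gagliardoQuot_mul u v σ s t)
  rw [he]
  refine Integrable.mul_bdd (c := δ ^ (σ + s - 2 * t)) hW.integrableOn
    hm.aestronglyMeasurable ?_
  refine (ae_restrict_iff' (measurableSet_strip n δ)).2 (Filter.Eventually.of_forall fun p hp => ?_)
  rw [Real.norm_of_nonneg (by positivity)]
  exact Real.rpow_le_rpow (norm_nonneg _) hp ht

/-- A bound `κ` for the interpolation error of `t ↦ r ^ (σ + s - 2 t)`, uniform in `r ≤ δ`, is one for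
the form, by Cauchy-Schwarz. -/
theorem abs_bilinForm_sub_interpForm_le {u v : 𝔼 → ℝ} {σ s δ a b κ : ℝ} {N : ℕ}
    (hu : MemLp (gagliardoQuot σ u) 2) (hv : MemLp (gagliardoQuot s v) 2)
    (hab : a ≤ b) (hs : s ∈ Icc a b) (hexp : ∀ t ∈ Icc a b, 0 ≤ σ + s - 2 * t) (hκ0 : 0 ≤ κ)
    (hκ : ∀ r : ℝ, 0 < r → r ≤ δ →
      |r ^ (σ + s - 2 * s) - ∑ m ∈ Finset.range N,
        (Lagrange.basis (Finset.range N) (chebNode a b N) m).eval s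
          * r ^ (σ + s - 2 * chebNode a b N m)| ≤ κ) :
    |bilinForm u v s δ - interpForm a b N u v s δ|
      ≤ κ * normHOmega σ u * normHOmega s v := by
  have hint : ∀ t ∈ Icc a b, IntegrableOn (formIntegrand u v t) (strip n δ) := fun t ht =>
    integrableOn_formIntegrand hu hv (hexp t ht)
  set ℓ : ℕ → ℝ := fun m => (Lagrange.basis (Finset.range N) (chebNode a b N) m).eval s with hℓ
  have hWabs : MemLp (fun p => |gagliardoQuot σ u p|) 2 ∧ MemLp (fun p => |gagliardoQuot s v p|) 2 :=
    ⟨hu.abs, hv.abs⟩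
  have hW : Integrable (fun p => |gagliardoQuot σ u p| * |gagliardoQuot s v p|) :=
    hWabs.1.integrable_mul hWabs.2
  have hdiff : bilinForm u v s δ - interpForm a b N u v s δ
      = ∫ p in strip n δ, (formIntegrand u v s p
          - ∑ m ∈ Finset.range N, ℓ m * formIntegrand u v (chebNode a b N m) p) := by
    have hm : ∀ m ∈ Finset.range N, IntegrableOn
        (fun p => ℓ m * formIntegrand u v (chebNode a b N m) p) (strip n δ) := fun m _ =>
      (hint _ (chebNode_mem_Icc hab N m)).const_mul _
    rw [integral_sub (hint s hs) (integrable_finsetSum _ hm), integral_finsetSum _ hm]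
    simp only [integral_const_mul, bilinForm, interpForm, hℓ]
  have hpt : ∀ p ∈ strip n δ, ‖formIntegrand u v s p
      - ∑ m ∈ Finset.range N, ℓ m * formIntegrand u v (chebNode a b N m) p‖
      ≤ κ * (|gagliardoQuot σ u p| * |gagliardoQuot s v p|) := by
    intro p hp
    rcases (norm_nonneg (p.1 - p.2)).eq_or_lt with h | h
    · have : p.1 = p.2 := sub_eq_zero.1 (norm_eq_zero.1 h.symm)
      simp [formIntegrand, gagliardoQuot, this]
    · have h1 : formIntegrand u v s p
          - ∑ m ∈ Finset.range N, ℓ m * formIntegrand u v (chebNode a b N m) p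
          = gagliardoQuot σ u p * gagliardoQuot s v p * (‖p.1 - p.2‖ ^ (σ + s - 2 * s)
            - ∑ m ∈ Finset.range N, ℓ m * ‖p.1 - p.2‖ ^ (σ + s - 2 * chebNode a b N m)) := by
        rw [mul_sub, Finset.mul_sum, ← formIntegrand_eq_gagliardoQuot_mul]
        congr 1
        refine Finset.sum_congr rfl fun m _ => ?_
        rw [formIntegrand_eq_gagliardoQuot_mul u v σ s]
        ring
      rw [h1, Real.norm_eq_abs, abs_mul, abs_mul, mul_comm κ]
      exact mul_le_mul_of_nonneg_left (hκ _ h hp) (by positivity)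
  rw [hdiff, ← Real.norm_eq_abs]
  calc _ ≤ ∫ p in strip n δ, κ * (|gagliardoQuot σ u p| * |gagliardoQuot s v p|) :=
        norm_integral_le_of_norm_le (hW.const_mul κ).integrableOn
          ((ae_restrict_iff' (measurableSet_strip n δ)).2 (Filter.Eventually.of_forall hpt))
    _ ≤ ∫ p, κ * (|gagliardoQuot σ u p| * |gagliardoQuot s v p|) :=
        setIntegral_le_integral (hW.const_mul κ)
          (Filter.Eventually.of_forall fun p => by positivity)
    _ = κ * ∫ p, |gagliardoQuot σ u p| * |gagliardoQuot s v p| := integral_const_mul _ _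
    _ ≤ κ * (normHOmega σ u * normHOmega s v) := by
        refine mul_le_mul_of_nonneg_left ?_ hκ0
        refine (le_abs_self _).trans ((abs_integral_mul_le_eLpNorm hWabs.1 hWabs.2).trans_eq ?_)
        rw [← toReal_eLpNorm_gagliardoQuot, ← toReal_eLpNorm_gagliardoQuot]
        simp only [← Real.norm_eq_abs, eLpNorm_norm]
    _ = _ := (mul_assoc _ _ _).symm

end Form

theorem lemma5p2 (δ ξ ε smax : ℝ) (hδ : 0 < δ) (hξ : ξ ∈ Ioo (1 / 10 : ℝ) (1 / 2))
    (hsmax : smax < 1) (hε : 0 < ε) (hε' : ε < min (1 - smax) (1 / 2)) :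
    (∀ smin : ℝ, 0 < smin → smin < smax →
      -- the rule produces a subdivision of `[smin, smax]` into finitely many subintervals
      (1 ≤ numIntervals ξ ε smin smax ∧
        breakpoint ξ ε smin smax 0 = smin ∧
        breakpoint ξ ε smin smax (numIntervals ξ ε smin smax) = smax ∧
        (∀ k < numIntervals ξ ε smin smax,
          breakpoint ξ ε smin smax k < breakpoint ξ ε smin smax (k + 1)) ∧
        (∀ k, k + 1 < numIntervals ξ ε smin smax →
          breakpoint ξ ε smin smax (k + 1) = breakpoint ξ ε smin smax k
            + (1 / 2 - ξ) * gap ε (breakpoint ξ ε smin smax k))) ∧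
      -- the error estimate
      ∀ η : ℝ, 0 < η → ∀ (n : ℕ), 1 ≤ n → ∀ Ω : Set (EuclideanSpace ℝ (Fin n)),
        IsOpen Ω → Bornology.IsBounded Ω →
        ∀ k < numIntervals ξ ε smin smax,
        ∀ s ∈ Icc (breakpoint ξ ε smin smax k) (breakpoint ξ ε smin smax (k + 1)),
        ∀ u v : EuclideanSpace ℝ (Fin n) → ℝ,
          MemHOmega Ω (s + 1 / 2 - ε) u → MemHOmega Ω s v →
          MemHOmega Ω (sBar ε (breakpoint ξ ε smin smax k)) u ∧
          (∀ t ∈ Icc (breakpoint ξ ε smin smax k) (breakpoint ξ ε smin smax (k + 1)),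
            IntegrableOn (formIntegrand u v t) (strip n δ)) ∧
          |bilinForm u v s δ
              - interpForm (breakpoint ξ ε smin smax k) (breakpoint ξ ε smin smax (k + 1))
                  (numNodes ξ ε δ η (breakpoint ξ ε smin smax k)) u v s δ|
            ≤ η * normHOmega (sBar ε (breakpoint ξ ε smin smax k)) u * normHOmega s v) ∧
    -- the total number of nodes
    (∀ ρ : ℝ, 0 < ρ → ∃ C : ℝ, 0 < C ∧ ∀ smin : ℝ, 0 < smin → smin < smax →
      ∀ η : ℝ, 0 < η → ρ ≤ |Real.log η| →
        ((∑ k ∈ Finset.range (numIntervals ξ ε smin smax),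
            numNodes ξ ε δ η (breakpoint ξ ε smin smax k) : ℕ) : ℝ) ≤ C * |Real.log η|) := by
  refine ⟨fun smin h0 h => ⟨breakpoint_subdivision hξ.2 hε' h0 h hsmax, ?_⟩,
    fun ρ hρ => sum_numNodes_le hξ hδ hsmax hε hε' hρ⟩
  intro η hη n hn Ω _ _ k hk s hs u v hu hv
  have ha := breakpoint_lt_smax h.le hk
  have ha0 := h0.trans_le (le_breakpoint hξ.2 hε' h.le k)
  have hab := breakpoint_lt_succ hξ.2 hε' ha
  have hb : breakpoint ξ ε smin smax (k + 1) ≤ breakpoint ξ ε smin smax k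
      + (1 / 2 - ξ) * gap ε (breakpoint ξ ε smin smax k) := min_le_right _ _
  have hb1 := breakpoint_le (ξ := ξ) (ε := ε) h.le (k + 1)
  set a := breakpoint ξ ε smin smax k
  set b := breakpoint ξ ε smin smax (k + 1)
  have hg : 0 < gap ε a := (gap_smax_pos hε').trans_le (gap_anti ε ha.le)
  have hg2 : gap ε a ≤ 1 / 2 := (sub_le_self _ hε.le).trans (min_le_right _ _)
  have hσ := sBar_eq_add_gap ε a
  have hσ1 : sBar ε a < 1 := by
    have := min_le_left 1 (a + 1 / 2)
    rw [sBar]; linarith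
  have hσr : sBar ε a ≤ s + 1 / 2 - ε := by
    have := min_le_right 1 (a + 1 / 2)
    rw [sBar]; linarith [hs.1]
  have hs0 : 0 < s := ha0.trans_le hs.1
  have hs1 : s < 1 := (hs.2.trans hb1).trans_lt hsmax
  have hu' : MemHOmega Ω (sBar ε a) u := hu.mono hn (by linarith) hσ1 hσr
  have huG := (memHOmega_iff_of_lt_one (by linarith) hσ1).1 hu' |>.1
  have hvG := (memHOmega_iff_of_lt_one hs0 hs1).1 hv |>.1
  have hexp : ∀ t ∈ Icc a b, 0 ≤ sBar ε a + s - 2 * t := by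
    intro t ht
    have : 0 < ξ := by linarith [hξ.1]
    have : 0 < ξ * gap ε a := by positivity
    rw [hσ]
    nlinarith [hs.1, ht.2]
  have hUq := memLp_gagliardoQuot huG.1.1 huG.2
  have hVq := memLp_gagliardoQuot hvG.1.1 hvG.2
  refine ⟨hu', fun t ht => integrableOn_formIntegrand hUq hVq (hexp t ht),
    abs_bilinForm_sub_interpForm_le hUq hVq hab.le hs hexp hη.le fun r hr hrδ => ?_⟩
  rw [hσ]
  exact (abs_rpow_sub_chebyshev_interp_le hδ hξ hg hg2 hab hb hs hr hrδ _).trans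
    (chebConst_mul_rate_pow_numNodes_le hξ hδ hη)
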